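/- There is an absolute constant $C>0$ such that the following holds. Let $G$ be a finite, simple, undirected, connected graph with $n\ge 2$ vertices, $m$ edges and minimum degree $d_{\min}$, and let $k\ge 1$ be an integer. Consider $k$ independent lazy random walks on $G$ (at each step a walk stays at its current vertex with probability $1/2$ and otherwise moves to a uniformly chosen neighbour), whose start vertices are sampled independently from the stationary distribution $\pi(v)=\deg(v)/(2m)$. Let $\tau_{\mathrm{cov}}^{(k)}$ be the first time $t\ge 0$ such that every vertex of $G$ has been visited by at least one of the walks at one of the times $0,1,\dots,t$, and let $t_{\mathrm{cov}}^{(k)}(\pi)$ be the expectation of $\tau_{\mathrm{cov}}^{(k)}$. Then \[ t_{\mathrm{cov}}^{(k)}(\pi)\;\le\; C\left(\frac{m}{k\,d_{\min}}\right)^2\log^2 n . \] -/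

import Mathlib

open MeasureTheory ProbabilityTheory
open scoped ENNReal

namespace MultiWalk

/-- One-step transition matrix of the lazy random walk on `G`: with probability `1/2` the walk stays
where it is, and otherwise it moves to a uniformly chosen neighbour. (By convention a walk at a
vertex without neighbours never moves; this does not occur in a connected graph with at least two
vertices.) -/
noncomputable def lazyMatrix {V : Type*} [Fintype V] [DecidableEq V] (G : SimpleGraph V)
    [DecidableRel G.Adj] : Matrix V V ℝ := fun u v =>
  if G.degree u = 0 then (if u = v then 1 else 0)
  else (1 / 2) * (if u = v then 1 else 0) + (1 / 2) * (if G.Adj u v then 1 / (G.degree u : ℝ) else 0)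

theorem lazyMatrix_nonneg {V : Type*} [Fintype V] [DecidableEq V] (G : SimpleGraph V)
    [DecidableRel G.Adj] (u v : V) : 0 ≤ lazyMatrix G u v := by
  unfold lazyMatrix
  split_ifs <;> positivity

theorem lazyMatrix_row_sum {V : Type*} [Fintype V] [DecidableEq V] (G : SimpleGraph V)
    [DecidableRel G.Adj] (u : V) : ∑ v, lazyMatrix G u v = 1 := by
  unfold lazyMatrix
  by_cases h : G.degree u = 0
  · simp [h]
  · have h' : (G.degree u : ℝ) ≠ 0 := by exact_mod_cast h
    simp only [h, if_false, Finset.sum_add_distrib, ← Finset.mul_sum]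
    rw [← Finset.sum_filter (fun v => G.Adj u v), ← SimpleGraph.neighborFinset_eq_filter G]
    simp only [Finset.sum_const, SimpleGraph.card_neighborFinset_eq_degree, nsmul_eq_mul,
      Finset.sum_ite_eq, Finset.mem_univ, if_true]
    field_simp
    norm_num

/-- The distribution of the position of the lazy walk one step after it was at `u`. -/
noncomputable def stepMeasure {V : Type*} [Fintype V] [DecidableEq V] [MeasurableSpace V]
    (G : SimpleGraph V) [DecidableRel G.Adj] (u : V) : Measure V :=
  ∑ v, ENNReal.ofReal (lazyMatrix G u v) • Measure.dirac v

instance {V : Type*} [Fintype V] [DecidableEq V] [MeasurableSpace V]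
    (G : SimpleGraph V) [DecidableRel G.Adj] (u : V) : IsProbabilityMeasure (stepMeasure G u) :=
  ⟨by
    simp only [stepMeasure, Measure.coe_finsetSum, Finset.sum_apply, Measure.smul_apply,
      measure_univ, smul_eq_mul, mul_one]
    rw [← ENNReal.ofReal_sum_of_nonneg (fun v _ => lazyMatrix_nonneg G u v),
      lazyMatrix_row_sum, ENNReal.ofReal_one]⟩

/-- The transition kernel from time `n` to time `n + 1`, given the history up to time `n`: it only
depends on the current position. -/
noncomputable def stepKernel {V : Type*} [Fintype V] [DecidableEq V] [MeasurableSpace V]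
    [MeasurableSingletonClass V] (G : SimpleGraph V) [DecidableRel G.Adj] (n : ℕ) :
    Kernel ((i : Finset.Iic n) → (fun _ : ℕ => V) i) ((fun _ : ℕ => V) (n + 1)) where
  toFun h := stepMeasure G (h ⟨n, Finset.mem_Iic.2 le_rfl⟩)
  measurable' := (measurable_of_countable (stepMeasure G)).comp (measurable_pi_apply _)

instance {V : Type*} [Fintype V] [DecidableEq V] [MeasurableSpace V]
    [MeasurableSingletonClass V] (G : SimpleGraph V) [DecidableRel G.Adj] (n : ℕ) :
    IsMarkovKernel (stepKernel G n) :=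
  ⟨fun h => inferInstanceAs
    (IsProbabilityMeasure (stepMeasure G (h ⟨n, Finset.mem_Iic.2 le_rfl⟩)))⟩

/-- The law, on trajectories `ℕ → V`, of a single lazy random walk on `G` whose start vertex has
distribution `μ`. -/
noncomputable def walkLaw {V : Type*} [Fintype V] [DecidableEq V] [MeasurableSpace V]
    [MeasurableSingletonClass V] (G : SimpleGraph V) [DecidableRel G.Adj] (μ : Measure V) :
    Measure (ℕ → V) :=
  Kernel.trajMeasure (X := fun _ : ℕ => V) μ (stepKernel G)

/-- The law of `k` independent lazy random walks on `G`, the start vertex of each being sampled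
independently from `μ`; the `i`-th walk is at `x i t` at time `t`. -/
noncomputable def multiWalkLaw {V : Type*} [Fintype V] [DecidableEq V] [MeasurableSpace V]
    [MeasurableSingletonClass V] (G : SimpleGraph V) [DecidableRel G.Adj] (μ : Measure V) (k : ℕ) :
    Measure (Fin k → ℕ → V) :=
  Measure.pi fun _ : Fin k => walkLaw G μ

/-- The stationary distribution `π(v) = d(v) / (2m)` of the walk on a graph with `m` edges. -/
noncomputable def stationary {V : Type*} [Fintype V] [DecidableEq V] [MeasurableSpace V]
    (G : SimpleGraph V) [DecidableRel G.Adj] : Measure V :=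
  ∑ v, ENNReal.ofReal ((G.degree v : ℝ) / (2 * (G.edgeFinset.card : ℝ))) • Measure.dirac v

/-- The cover time: the first `t` such that each vertex is visited by at least one of the `k` walks
at one of the times `0, …, t`; it is `∞` if there is no such `t`. -/
noncomputable def coverTime {V : Type*} {k : ℕ} (x : Fin k → ℕ → V) : ℝ≥0∞ :=
  sInf {r : ℝ≥0∞ | ∃ t : ℕ, r = t ∧ ∀ v : V, ∃ i : Fin k, ∃ s ≤ t, x i s = v}

/-- The expected cover time of `k` independent lazy walks on `G` with start vertices sampled
independently from `μ`. -/
noncomputable def expectedCoverTime {V : Type*} [Fintype V] [DecidableEq V] [MeasurableSpace V]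
    [MeasurableSingletonClass V] (G : SimpleGraph V) [DecidableRel G.Adj] (μ : Measure V) (k : ℕ) :
    ℝ≥0∞ :=
  ∫⁻ x, coverTime x ∂(multiWalkLaw G μ k)

end MultiWalk

/-! Fix `v` and let `q t` (`survival`) be the stationary probability that one walk avoids `v` up to
time `t`. The claim is that `q t ≤ exp (-(d/(26m)) √(t+1))`, with `d` the minimum degree.
Independence raises this to the `k`-th power, a union bound over `v` adds a factor `n`, and summing
over `t` gives `O((m log n/(k d))²)`.

For the decay, reversibility makes the walk killed at `v` self-adjoint for the degree weights, so `q
(2s) - q (2s+1)` is the Dirichlet energy of `avoid G v s` over `8m` (`survival_sub`). This function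
vanishes at `v`, and a geodesic through points of minimum degree `d` needs large volume
(`sub_one_mul_minDegree_sq_le`). Hence the energy is large: of order `d²/(m(1-q))` while `q ≥ 1/2`
(`edgeEnergy_avoid_ge_of_half_le`), and by a Poincaré inequality of order `d² q/m` afterwards
(`sum_degree_mul_sq_le`). Both regimes give `(-log q)(q - q') ≥ (d/m)² q/640` (`survival_sub_ge`),
so `(log q)²` grows at least linearly in time (`log_survival_sq_ge`). -/

namespace MultiWalk

/-! ### Avoidance probabilities, Dirichlet energy and geodesics. -/

section Deterministic

set_option linter.unusedSectionVars false

variable {V : Type*} [Fintype V] [DecidableEq V] (G : SimpleGraph V) [DecidableRel G.Adj]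

/-- `avoid G v t u` is the probability that the lazy walk started at `u` does not visit `v` at any
of the times `0, …, t`. -/
noncomputable def avoid (v : V) : ℕ → V → ℝ
  | 0, u => if u = v then 0 else 1
  | t + 1, u => if u = v then 0 else ∑ w, lazyMatrix G u w * avoid v t w

/-- The degree-weighted sum of the avoidance probabilities. -/
noncomputable def avoidMass (v : V) (t : ℕ) : ℝ := ∑ u, (G.degree u : ℝ) * avoid G v t u

/-- The Dirichlet energy of `f`, each edge being counted in both directions. -/
noncomputable def edgeEnergy (f : V → ℝ) : ℝ :=
  ∑ x, ∑ y, if G.Adj x y then (f x - f y) ^ 2 else 0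

theorem degree_mul_lazyMatrix (u w : V) : (G.degree u : ℝ) * lazyMatrix G u w =
    (1 / 2) * ((if u = w then (G.degree u : ℝ) else 0) + if G.Adj u w then 1 else 0) := by
  unfold lazyMatrix
  by_cases h : G.degree u = 0
  · have hn : ¬ G.Adj u w := fun hu => by
      have := (G.degree_pos_iff_exists_adj u).2 ⟨w, hu⟩
      omega
    simp [h, hn]
  · have h' : (G.degree u : ℝ) ≠ 0 := by exact_mod_cast h
    simp only [h, if_false]
    split_ifs <;> field_simp <;> ring

theorem degree_mul_lazyMatrix_symm (u w : V) :
    (G.degree u : ℝ) * lazyMatrix G u w = (G.degree w : ℝ) * lazyMatrix G w u := by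
  rw [degree_mul_lazyMatrix, degree_mul_lazyMatrix]
  by_cases h : u = w
  · subst h; rfl
  · simp [h, Ne.symm h, G.adj_comm u w]

variable {G}

theorem avoid_self (v : V) (t : ℕ) : avoid G v t v = 0 := by
  cases t <;> simp [avoid]

theorem avoid_nonneg (v : V) (t : ℕ) (u : V) : 0 ≤ avoid G v t u := by
  induction t generalizing u with
  | zero => unfold avoid; split_ifs <;> norm_num
  | succ t ih =>
    unfold avoid
    split_ifs
    · exact le_rfl
    · exact Finset.sum_nonneg fun w _ => mul_nonneg (lazyMatrix_nonneg G u w) (ih w)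

theorem avoid_succ_le (v : V) (t : ℕ) (u : V) : avoid G v (t + 1) u ≤ avoid G v t u := by
  induction t generalizing u with
  | zero =>
    simp only [avoid]
    split_ifs
    · exact le_rfl
    · refine (Finset.sum_le_sum fun w _ => ?_).trans_eq (lazyMatrix_row_sum G u)
      have := lazyMatrix_nonneg G u w
      split_ifs <;> simp [this]
  | succ t ih =>
    rw [avoid, avoid]
    split_ifs
    · exact le_rfl
    · exact Finset.sum_le_sum fun w _ => mul_le_mul_of_nonneg_left (ih w) (lazyMatrix_nonneg G u w)

theorem avoid_antitone (v u : V) : Antitone fun t => avoid G v t u :=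
  antitone_nat_of_succ_le fun t => avoid_succ_le v t u

theorem avoid_le_one (v : V) (t : ℕ) (u : V) : avoid G v t u ≤ 1 := by
  refine (avoid_antitone v u (Nat.zero_le t)).trans ?_
  simp only [avoid]
  split_ifs <;> norm_num

theorem avoidMass_nonneg (v : V) (t : ℕ) : 0 ≤ avoidMass G v t :=
  Finset.sum_nonneg fun u _ => mul_nonneg (Nat.cast_nonneg _) (avoid_nonneg v t u)

theorem avoidMass_antitone (v : V) : Antitone (avoidMass G v) := fun _ _ h =>
  Finset.sum_le_sum fun u _ => mul_le_mul_of_nonneg_left (avoid_antitone v u h) (Nat.cast_nonneg _)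

theorem sum_mul_avoid_succ (v : V) (s t : ℕ) :
    ∑ u, (G.degree u : ℝ) * (avoid G v (s + 1) u * avoid G v t u) =
      ∑ u, ∑ w, (G.degree u : ℝ) * lazyMatrix G u w * (avoid G v s w * avoid G v t u) := by
  refine Finset.sum_congr rfl fun u _ => ?_
  by_cases h : u = v
  · subst h; simp [avoid_self]
  · rw [avoid, if_neg h, Finset.sum_mul, Finset.mul_sum]
    exact Finset.sum_congr rfl fun w _ => by ring

/-- The killed transition operator is self-adjoint for the degree weights, so one step can be moved
from one factor to the other. -/
theorem sum_avoid_mul_avoid_shift (v : V) (s t : ℕ) :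
    ∑ u, (G.degree u : ℝ) * (avoid G v (s + 1) u * avoid G v t u) =
      ∑ u, (G.degree u : ℝ) * (avoid G v s u * avoid G v (t + 1) u) := by
  have h : ∀ u, (G.degree u : ℝ) * (avoid G v s u * avoid G v (t + 1) u) =
      (G.degree u : ℝ) * (avoid G v (t + 1) u * avoid G v s u) := fun u => by ring
  rw [Finset.sum_congr rfl fun u _ => h u, sum_mul_avoid_succ, sum_mul_avoid_succ,
    Finset.sum_comm]
  refine Finset.sum_congr rfl fun u _ => Finset.sum_congr rfl fun w _ => ?_
  rw [degree_mul_lazyMatrix_symm]; ring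

/-- Moving all `s` steps to the second factor leaves the indicator of `u ≠ v` in the first. -/
theorem sum_avoid_mul_avoid (v : V) (s t : ℕ) :
    ∑ u, (G.degree u : ℝ) * (avoid G v s u * avoid G v t u) = avoidMass G v (s + t) := by
  induction s generalizing t with
  | zero =>
    rw [avoidMass, zero_add]
    refine Finset.sum_congr rfl fun u _ => ?_
    by_cases h : u = v
    · subst h; simp [avoid_self]
    · simp [avoid, h]
  | succ s ih => rw [sum_avoid_mul_avoid_shift, ih]; congr 1; ring

theorem sum_adj_left (f : V → ℝ) :
    (∑ x, ∑ y, if G.Adj x y then f x else 0) = ∑ x, (G.degree x : ℝ) * f x := by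
  refine Finset.sum_congr rfl fun x _ => ?_
  rw [← Finset.sum_filter, ← SimpleGraph.neighborFinset_eq_filter G, Finset.sum_const,
    SimpleGraph.card_neighborFinset_eq_degree, nsmul_eq_mul]

theorem sum_adj_right (f : V → ℝ) :
    (∑ x, ∑ y, if G.Adj x y then f y else 0) = ∑ x, (G.degree x : ℝ) * f x := by
  rw [Finset.sum_comm, ← sum_adj_left]
  simp only [G.adj_comm]

/-- With `f = avoid G v s`, the two masses are `⟨f, f⟩` and `⟨P f, f⟩`. Laziness puts a factor `1/2`
on `I - P`, and the double count of edges in `edgeEnergy` supplies the other. -/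
theorem avoidMass_sub (v : V) (s : ℕ) :
    avoidMass G v (2 * s) - avoidMass G v (2 * s + 1) = edgeEnergy G (avoid G v s) / 4 := by
  have h1 := sum_avoid_mul_avoid (G := G) v s s
  have h2 := sum_avoid_mul_avoid (G := G) v (s + 1) s
  rw [sum_mul_avoid_succ] at h2
  rw [show 2 * s + 1 = s + 1 + s by ring, show 2 * s = s + s by ring, ← h1, ← h2]
  set f := avoid G v s
  have h3 : ∑ u, ∑ w, (G.degree u : ℝ) * lazyMatrix G u w * (f w * f u) =
      (1 / 2) * (∑ u, (G.degree u : ℝ) * (f u * f u)) +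
        (1 / 2) * ∑ u, ∑ w, if G.Adj u w then f u * f w else 0 := by
    rw [Finset.mul_sum, Finset.mul_sum, ← Finset.sum_add_distrib]
    refine Finset.sum_congr rfl fun u _ => ?_
    have : ∀ w, (G.degree u : ℝ) * lazyMatrix G u w * (f w * f u) =
        (1 / 2) * (if u = w then (G.degree u : ℝ) * (f w * f u) else 0) +
          (1 / 2) * (if G.Adj u w then f u * f w else 0) := fun w => by
      rw [degree_mul_lazyMatrix]; split_ifs <;> ring
    rw [Finset.sum_congr rfl fun w _ => this w, Finset.sum_add_distrib, ← Finset.mul_sum,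
      ← Finset.mul_sum, Finset.sum_ite_eq, if_pos (Finset.mem_univ u)]
  have h4 : edgeEnergy G f = 2 * (∑ u, (G.degree u : ℝ) * (f u * f u)) -
      2 * ∑ u, ∑ w, if G.Adj u w then f u * f w else 0 := by
    have : edgeEnergy G f = (∑ x, ∑ y, if G.Adj x y then f x * f x else 0) +
        (∑ x, ∑ y, if G.Adj x y then f y * f y else 0) -
        2 * ∑ u, ∑ w, if G.Adj u w then f u * f w else 0 := by
      simp only [edgeEnergy, Finset.mul_sum, ← Finset.sum_add_distrib, ← Finset.sum_sub_distrib]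
      refine Finset.sum_congr rfl fun x _ => Finset.sum_congr rfl fun y _ => ?_
      split_ifs <;> ring
    rw [this, sum_adj_left (fun x => f x * f x), sum_adj_right (fun x => f x * f x)]
    ring
  rw [h3, h4]; ring

theorem edgeEnergy_nonneg (f : V → ℝ) : 0 ≤ edgeEnergy G f :=
  Finset.sum_nonneg fun _ _ => Finset.sum_nonneg fun _ _ => by split_ifs <;> positivity

theorem exists_geodesic (hG : G.Connected) (v u : V) : ∃ p : ℕ → V, p 0 = v ∧ p (G.dist v u) = u ∧
    (∀ i < G.dist v u, G.Adj (p i) (p (i + 1))) ∧ ∀ i ≤ G.dist v u, G.dist v (p i) = i := by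
  obtain ⟨p, hp⟩ := hG.exists_walk_length_eq_dist v u
  refine ⟨p.getVert, p.getVert_zero, hp ▸ p.getVert_length,
    fun i hi => p.adj_getVert_succ (hp ▸ hi), fun i hi => ?_⟩
  have h1 := SimpleGraph.dist_le (p.take i)
  have h2 := SimpleGraph.dist_le (p.drop i)
  have h3 := hG.dist_triangle (u := v) (v := p.getVert i) (w := u)
  simp only [SimpleGraph.Walk.take_length, SimpleGraph.Walk.drop_length] at h1 h2
  omega

/-- Cauchy–Schwarz on the telescoping sum of `f` along a geodesic. -/
theorem sq_sub_le_dist_mul_edgeEnergy (hG : G.Connected) (f : V → ℝ) (v u : V) :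
    (f u - f v) ^ 2 ≤ G.dist v u * edgeEnergy G f := by
  obtain ⟨p, h0, hD, hadj, hdist⟩ := exists_geodesic hG v u
  set D := G.dist v u
  have htel : f u - f v = ∑ i ∈ Finset.range D, (f (p (i + 1)) - f (p i)) := by
    rw [Finset.sum_range_sub (fun i => f (p i)), h0, hD]
  have hcs := sq_sum_le_card_mul_sum_sq (s := Finset.range D)
    (f := fun i => f (p (i + 1)) - f (p i))
  rw [← htel, Finset.card_range] at hcs
  refine hcs.trans (mul_le_mul_of_nonneg_left ?_ (Nat.cast_nonneg _))
  set F : V × V → ℝ := fun z => if G.Adj z.1 z.2 then (f z.1 - f z.2) ^ 2 else 0 with hF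
  have hE : edgeEnergy G f = ∑ z, F z := by
    rw [edgeEnergy, Fintype.sum_prod_type]
  -- The distance to `v` identifies the position on the geodesic, so no edge is counted twice.
  have hinj : Set.InjOn (fun i => (p i, p (i + 1))) (Finset.range D : Set ℕ) := by
    intro i hi j hj hij
    simp only [Finset.coe_range, Set.mem_Iio] at hi hj
    have h : p i = p j := (Prod.ext_iff.1 hij).1
    rw [← hdist i hi.le, ← hdist j hj.le, h]
  rw [hE, Finset.sum_congr rfl (g := fun i => F (p i, p (i + 1)))
    (fun i hi => by simp [hF, hadj i (Finset.mem_range.1 hi)]; ring),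
    ← Finset.sum_image (f := F) (g := fun i => (p i, p (i + 1))) hinj]
  exact Finset.sum_le_univ_sum_of_nonneg fun z => by
    simp only [hF]; split_ifs <;> positivity

/-- A geodesic of length `D` has large volume around it: if `g ≥ c` at distance less than `D`
from `v`, then `g` has degree-weighted sum at least a constant times `(D - 1) d² c`. -/
theorem sub_one_mul_minDegree_sq_le (hG : G.Connected) (g : V → ℝ) (hg : ∀ x, 0 ≤ g x) (v u : V)
    {c : ℝ} (hc : 0 ≤ c) (hgc : ∀ x, G.dist v x < G.dist v u → c ≤ g x) :
    ((G.dist v u : ℝ) - 1) * (G.minDegree : ℝ) ^ 2 * c ≤ 3 * ∑ x, (G.degree x : ℝ) * g x := by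
  obtain ⟨p, h0, hD, hadj, hdist⟩ := exists_geodesic hG v u
  set D := G.dist v u
  have hdeg : ∀ x, (G.minDegree : ℝ) ≤ G.degree x := fun x => by
    exact_mod_cast G.minDegree_le_degree x
  -- Neighbours differ by at most one in distance to `v`, so `y` sees at most three levels of the
  -- geodesic.
  have hcount : ∀ y, ((Finset.range (D - 1)).filter fun i => G.Adj (p i) y).card ≤ 3 := by
    intro y
    refine (Finset.card_le_card (t := Finset.Icc (G.dist v y - 1) (G.dist v y + 1)) ?_).trans ?_
    · intro i hi
      rw [Finset.mem_filter, Finset.mem_range] at hi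
      have h1 := hdist i (by omega)
      have h2 := SimpleGraph.dist_eq_one_iff_adj.2 hi.2
      have h3 := hG.dist_triangle (u := v) (v := p i) (w := y)
      have h4 := hG.dist_triangle (u := v) (v := y) (w := p i)
      rw [SimpleGraph.dist_comm (u := y)] at h4
      rw [Finset.mem_Icc]; omega
    · rw [Nat.card_Icc]; omega
  -- Stopping at `i < D - 1` keeps every neighbour of `p i` at distance less than `D`, where `g ≥
  -- c`. One factor `d` counts the neighbours, the other bounds their degrees.
  have hlow : ∀ i ∈ Finset.range (D - 1), (G.minDegree : ℝ) ^ 2 * c ≤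
      ∑ y, if G.Adj (p i) y then (G.degree y : ℝ) * g y else 0 := by
    intro i hi
    rw [Finset.mem_range] at hi
    rw [← Finset.sum_filter, ← SimpleGraph.neighborFinset_eq_filter G]
    have : ∀ y ∈ G.neighborFinset (p i), (G.minDegree : ℝ) * c ≤ (G.degree y : ℝ) * g y := by
      intro y hy
      rw [SimpleGraph.mem_neighborFinset] at hy
      refine mul_le_mul (hdeg y) (hgc y ?_) hc (Nat.cast_nonneg _)
      have h1 := hdist i (by omega)
      have h2 := SimpleGraph.dist_eq_one_iff_adj.2 hy
      have h3 := hG.dist_triangle (u := v) (v := p i) (w := y)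
      omega
    have h5 := Finset.card_nsmul_le_sum _ _ _ this
    rw [SimpleGraph.card_neighborFinset_eq_degree, nsmul_eq_mul] at h5
    refine le_trans ?_ h5
    rw [sq, mul_assoc]
    exact mul_le_mul_of_nonneg_right (hdeg _) (by positivity)
  have hsum := Finset.sum_le_sum hlow
  rw [Finset.sum_const, Finset.card_range, nsmul_eq_mul, Finset.sum_comm] at hsum
  have hup : ∑ y, ∑ i ∈ Finset.range (D - 1), (if G.Adj (p i) y then (G.degree y : ℝ) * g y else 0)
      ≤ 3 * ∑ x, (G.degree x : ℝ) * g x := by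
    rw [Finset.mul_sum]
    refine Finset.sum_le_sum fun y _ => ?_
    rw [← Finset.sum_filter, Finset.sum_const, nsmul_eq_mul]
    exact mul_le_mul_of_nonneg_right (by exact_mod_cast hcount y)
      (mul_nonneg (Nat.cast_nonneg _) (hg y))
  have hD1 : (D : ℝ) - 1 ≤ ((D - 1 : ℕ) : ℝ) := by
    have : D ≤ D - 1 + 1 := by omega
    have : (D : ℝ) ≤ ((D - 1 : ℕ) : ℝ) + 1 := by exact_mod_cast this
    linarith
  calc ((D : ℝ) - 1) * (G.minDegree : ℝ) ^ 2 * c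
      ≤ ((D - 1 : ℕ) : ℝ) * ((G.minDegree : ℝ) ^ 2 * c) := by
        rw [mul_assoc]; exact mul_le_mul_of_nonneg_right hD1 (by positivity)
    _ ≤ _ := hsum.trans hup

end Deterministic

end MultiWalk

namespace MultiWalk

/-! ### Decay of the survival probability. -/

section Decay

set_option linter.unusedSectionVars false

variable {V : Type*} [Fintype V] [DecidableEq V] {G : SimpleGraph V} [DecidableRel G.Adj]

/-- The stationary probability of avoiding `v` up to time `t`. -/
noncomputable def survival (G : SimpleGraph V) [DecidableRel G.Adj] (v : V) (t : ℕ) : ℝ :=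
  avoidMass G v t / (2 * (G.edgeFinset.card : ℝ))

theorem sum_degree_real :
    ∑ x, (G.degree x : ℝ) = 2 * (G.edgeFinset.card : ℝ) := by
  exact_mod_cast G.sum_degrees_eq_twice_card_edges

theorem minDegree_pos (hG : G.Connected) (hV : 2 ≤ Fintype.card V) : 0 < G.minDegree := by
  have : Nontrivial V := Fintype.one_lt_card_iff_nontrivial.1 hV
  exact hG.preconnected.minDegree_pos_of_nontrivial

theorem minDegree_sq_le : (G.minDegree : ℝ) ^ 2 ≤ 2 * (G.edgeFinset.card : ℝ) := by
  rw [← sum_degree_real]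
  rcases isEmpty_or_nonempty V with hV | ⟨⟨v⟩⟩
  · simp
  have h1 : ∀ x ∈ G.neighborFinset v, (G.minDegree : ℝ) ≤ G.degree x := fun x _ => by
    exact_mod_cast G.minDegree_le_degree x
  have h2 := Finset.card_nsmul_le_sum _ _ _ h1
  rw [SimpleGraph.card_neighborFinset_eq_degree, nsmul_eq_mul] at h2
  have h3 : (G.minDegree : ℝ) ≤ G.degree v := by exact_mod_cast G.minDegree_le_degree v
  have h4 := Finset.sum_le_univ_sum_of_nonneg (s := G.neighborFinset v)
    (f := fun x => (G.degree x : ℝ)) (fun x => Nat.cast_nonneg _)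
  nlinarith [(Nat.cast_nonneg G.minDegree : (0 : ℝ) ≤ _)]

theorem edgeFinset_card_pos (hG : G.Connected) (hV : 2 ≤ Fintype.card V) :
    (0 : ℝ) < G.edgeFinset.card := by
  have h1 : (1 : ℝ) ≤ G.minDegree := by exact_mod_cast minDegree_pos hG hV
  have := minDegree_sq_le (G := G)
  nlinarith

theorem survival_nonneg (v : V) (t : ℕ) : 0 ≤ survival G v t :=
  div_nonneg (avoidMass_nonneg v t) (by positivity)

theorem survival_antitone (v : V) : Antitone (survival G v) := fun _ _ h =>
  div_le_div_of_nonneg_right (avoidMass_antitone v h) (by positivity)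

theorem avoidMass_zero (v : V) : avoidMass G v 0 = 2 * (G.edgeFinset.card : ℝ) - G.degree v := by
  rw [← sum_degree_real, avoidMass]
  have : ∀ u, (G.degree u : ℝ) * avoid G v 0 u =
      (G.degree u : ℝ) - if u = v then (G.degree u : ℝ) else 0 := fun u => by
    simp only [avoid]; split_ifs <;> simp
  simp [this]

theorem survival_zero_le (hG : G.Connected) (hV : 2 ≤ Fintype.card V) (v : V) :
    survival G v 0 ≤ 1 - (G.minDegree : ℝ) / (2 * (G.edgeFinset.card : ℝ)) := by
  have hm := edgeFinset_card_pos hG hV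
  have h3 : (G.minDegree : ℝ) ≤ G.degree v := by exact_mod_cast G.minDegree_le_degree v
  rw [survival, avoidMass_zero, div_le_iff₀ (by positivity)]
  field_simp
  linarith

theorem survival_sub (v : V) (s : ℕ) :
    survival G v (2 * s) - survival G v (2 * s + 1) =
      edgeEnergy G (avoid G v s) / (8 * (G.edgeFinset.card : ℝ)) := by
  rw [survival, survival, ← sub_div, avoidMass_sub, div_div]
  congr 1; ring

theorem sum_degree_mul_one_sub_avoid (hG : G.Connected) (hV : 2 ≤ Fintype.card V) (v : V) (s : ℕ) :
    ∑ x, (G.degree x : ℝ) * (1 - avoid G v s x) =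
      2 * (G.edgeFinset.card : ℝ) * (1 - survival G v s) := by
  have hm := edgeFinset_card_pos hG hV
  simp only [mul_sub, mul_one, Finset.sum_sub_distrib, sum_degree_real]
  rw [survival, avoidMass]
  field_simp

/-- The Dirichlet energy is at least `deg v - 2 ∑_{u ∼ v} (1 - f u)` when `f v = 0`. -/
theorem degree_sub_le_edgeEnergy (f : V → ℝ) (v : V) (hv : f v = 0) :
    (G.degree v : ℝ) - 2 * ∑ u ∈ G.neighborFinset v, (1 - f u) ≤ edgeEnergy G f := by
  have h1 : (∑ y, if G.Adj v y then (f v - f y) ^ 2 else 0) ≤ edgeEnergy G f :=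
    Finset.single_le_sum (f := fun x => ∑ y, if G.Adj x y then (f x - f y) ^ 2 else 0)
      (fun x _ => Finset.sum_nonneg fun y _ => by split_ifs <;> positivity) (Finset.mem_univ v)
  refine le_trans ?_ h1
  rw [← Finset.sum_filter, ← SimpleGraph.neighborFinset_eq_filter G,
    ← SimpleGraph.card_neighborFinset_eq_degree, Finset.cast_card, Finset.mul_sum,
    ← Finset.sum_sub_distrib]
  refine Finset.sum_le_sum fun u _ => ?_
  -- Termwise, `f² ≥ 2f - 1 = 1 - 2(1 - f)`.
  rw [hv]; nlinarith [sq_nonneg (f u - 1)]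

/-- Lower bound on the energy while the hitting probability is at most `1/2`. -/
theorem edgeEnergy_avoid_ge_of_half_le (hG : G.Connected) (hV : 2 ≤ Fintype.card V) (v : V) (s : ℕ)
    {h : ℝ} (hh : 1 - survival G v s ≤ h) (hh2 : h ≤ 1 / 2)
    (hd : (G.minDegree : ℝ) / (2 * (G.edgeFinset.card : ℝ)) ≤ h) :
    (G.minDegree : ℝ) ^ 2 / (80 * (G.edgeFinset.card : ℝ) * h) ≤ edgeEnergy G (avoid G v s) := by
  have hm := edgeFinset_card_pos hG hV
  have hd1 : (1 : ℝ) ≤ G.minDegree := by exact_mod_cast minDegree_pos hG hV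
  have hmass := sum_degree_mul_one_sub_avoid hG hV v s
  set m : ℝ := (G.edgeFinset.card : ℝ)
  set d : ℝ := (G.minDegree : ℝ)
  set E := edgeEnergy G (avoid G v s)
  have hdeg : ∀ x, d ≤ G.degree x := fun x => Nat.cast_le.2 (G.minDegree_le_degree x)
  have hg : ∀ x, 0 ≤ 1 - avoid G v s x := fun x => sub_nonneg.2 (avoid_le_one v s x)
  have hhpos : 0 < h := lt_of_lt_of_le (by positivity) hd
  have hmh : ∑ x, (G.degree x : ℝ) * (1 - avoid G v s x) ≤ 2 * m * h := by
    rw [hmass]; exact mul_le_mul_of_nonneg_left hh (by positivity)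
  rw [div_le_iff₀ (by positivity)] at hd ⊢
  -- If the hit mass `2mh` is at most `d²/4`, it is too small to fill the neighbourhood of `v`, and
  -- the edges at `v` alone carry energy `d/2`; this suffices because `d ≤ 2mh`.
  by_cases hcase : 8 * m * h ≤ d ^ 2
  · have h1 := degree_sub_le_edgeEnergy (G := G) (avoid G v s) v (avoid_self v s)
    have h2 : d * ∑ u ∈ G.neighborFinset v, (1 - avoid G v s u) ≤ 2 * m * h := by
      refine le_trans ?_ hmh
      rw [Finset.mul_sum]
      refine le_trans (Finset.sum_le_sum fun u _ => mul_le_mul_of_nonneg_right (hdeg u) (hg u)) ?_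
      exact Finset.sum_le_univ_sum_of_nonneg fun u => mul_nonneg (Nat.cast_nonneg _) (hg u)
    have h3 : ∑ u ∈ G.neighborFinset v, (1 - avoid G v s u) ≤ d / 4 := by
      have : d * ∑ u ∈ G.neighborFinset v, (1 - avoid G v s u) ≤ d * (d / 4) := by nlinarith
      exact le_of_mul_le_mul_left this (by linarith)
    have h4 : d / 2 ≤ E := by linarith [hdeg v]
    nlinarith
  · push Not at hcase
    -- Otherwise the mean hitting probability would exceed `1/2`. At the nearest such `u`, all
    -- closer vertices have hitting probability at least `1/2`; this bounds `dist v u` by volume,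
    -- while `avoid` rises from `0` to at least `1/2` along the geodesic.
    have hex : ∃ u, 1 / 2 ≤ avoid G v s u := by
      by_contra! hno
      have : ∑ x, (G.degree x : ℝ) * (1 / 2) < ∑ x, (G.degree x : ℝ) * (1 - avoid G v s x) := by
        refine Finset.sum_lt_sum_of_nonempty ⟨v, Finset.mem_univ v⟩ fun x _ => ?_
        exact mul_lt_mul_of_pos_left (by linarith [hno x]) (by linarith [hdeg x])
      rw [← Finset.sum_mul, sum_degree_real] at this
      change 2 * m * (1 / 2) < _ at this
      nlinarith
    obtain ⟨u, hu, hmin⟩ := Finset.exists_min_image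
      (Finset.univ.filter fun u => 1 / 2 ≤ avoid G v s u) (fun u => G.dist v u)
      (by obtain ⟨u, hu⟩ := hex; exact ⟨u, by simpa using hu⟩)
    rw [Finset.mem_filter] at hu
    have h1 := sub_one_mul_minDegree_sq_le hG (fun x => 1 - avoid G v s x) hg v u
      (c := 1 / 2) (by norm_num) (fun x hx => by
        by_contra! hlt
        have := hmin x (by rw [Finset.mem_filter]; exact ⟨Finset.mem_univ x, by linarith⟩)
        omega)
    have h2 := sq_sub_le_dist_mul_edgeEnergy hG (avoid G v s) v u
    rw [avoid_self, sub_zero] at h2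
    have h3 : (G.dist v u : ℝ) * d ^ 2 ≤ 20 * m * h := by
      change ((G.dist v u : ℝ) - 1) * d ^ 2 * (1 / 2) ≤ _ at h1
      nlinarith
    have h4 : 1 / 4 ≤ (G.dist v u : ℝ) * E := by
      have := hu.2
      change _ ≤ (G.dist v u : ℝ) * E at h2
      nlinarith
    have hE : 0 ≤ E := edgeEnergy_nonneg _
    have h5 := mul_le_mul_of_nonneg_right h3 hE
    have h6 := mul_le_mul_of_nonneg_left h4 (sq_nonneg d)
    nlinarith

/-- Poincaré inequality for functions vanishing at a vertex. -/
theorem sum_degree_mul_sq_le (hG : G.Connected) (f : V → ℝ) (v : V) (hv : f v = 0) :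
    (G.minDegree : ℝ) ^ 2 * ∑ x, (G.degree x : ℝ) * (f x * f x) ≤
      16 * (G.edgeFinset.card : ℝ) ^ 2 * edgeEnergy G f := by
  have hpt : ∀ x, (G.minDegree : ℝ) ^ 2 * (f x * f x) ≤
      8 * (G.edgeFinset.card : ℝ) * edgeEnergy G f := fun x => by
    have h1 := sub_one_mul_minDegree_sq_le hG (fun _ => 1) (fun _ => zero_le_one) v x zero_le_one
      (fun _ _ => le_rfl)
    simp only [mul_one, sum_degree_real] at h1
    have h2 := sq_sub_le_dist_mul_edgeEnergy hG f v x
    rw [hv, sub_zero] at h2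
    have h3 := minDegree_sq_le (G := G)
    -- The volume bound gives `(dist - 1) d² ≤ 6m`, and `d² ≤ 2m` absorbs the `-1`.
    have h4 : (G.dist v x : ℝ) * (G.minDegree : ℝ) ^ 2 ≤ 8 * (G.edgeFinset.card : ℝ) := by
      linarith
    have h5 := mul_le_mul_of_nonneg_right h4 (edgeEnergy_nonneg (G := G) f)
    have h6 := mul_le_mul_of_nonneg_left h2 (sq_nonneg (G.minDegree : ℝ))
    nlinarith
  rw [Finset.mul_sum]
  calc _ ≤ ∑ x, (G.degree x : ℝ) * (8 * (G.edgeFinset.card : ℝ) * edgeEnergy G f) :=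
        Finset.sum_le_sum fun x _ => by
          have := mul_le_mul_of_nonneg_left (hpt x) (Nat.cast_nonneg (G.degree x))
          linarith
    _ = _ := by rw [← Finset.sum_mul, sum_degree_real]; ring

/-- The basic recursion for the decay of the survival probability. -/
theorem survival_sub_ge (hG : G.Connected) (hV : 2 ≤ Fintype.card V) (v : V) (s : ℕ)
    (hpos : 0 < survival G v (2 * s)) :
    ((G.minDegree : ℝ) / (G.edgeFinset.card : ℝ)) ^ 2 / 640 * survival G v (2 * s) ≤
      -Real.log (survival G v (2 * s)) *
        (survival G v (2 * s) - survival G v (2 * s + 1)) := by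
  have hm := edgeFinset_card_pos hG hV
  have hd1 : (1 : ℝ) ≤ G.minDegree := by exact_mod_cast minDegree_pos hG hV
  have h0 := survival_zero_le hG hV v
  have hq0 : survival G v (2 * s) ≤ survival G v 0 := survival_antitone v (Nat.zero_le _)
  have hqs : survival G v (2 * s) ≤ survival G v s := survival_antitone v (by omega)
  have hq : survival G v (2 * s) = avoidMass G v (2 * s) / (2 * (G.edgeFinset.card : ℝ)) := rfl
  rw [survival_sub]
  rw [two_mul s, ← sum_avoid_mul_avoid, ← two_mul] at hq
  have hA := edgeEnergy_avoid_ge_of_half_le hG hV v s (h := 1 - survival G v (2 * s))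
  have hB := sum_degree_mul_sq_le hG (avoid G v s) v (avoid_self v s)
  have hlog := Real.log_le_sub_one_of_pos hpos
  have hE := edgeEnergy_nonneg (G := G) (avoid G v s)
  set q := survival G v (2 * s)
  set m : ℝ := (G.edgeFinset.card : ℝ)
  set d : ℝ := (G.minDegree : ℝ)
  set E := edgeEnergy G (avoid G v s)
  have hdm : 0 < d / (2 * m) := by positivity
  have hh : 0 < 1 - q := by linarith
  -- `-log q ≥ 1 - q` serves both regimes: it cancels the `1/(1-q)` in the first energy bound, and
  -- is at least `1/2` in the second.
  have hkey : (d / m) ^ 2 / 640 * q * (8 * m) ≤ (1 - q) * E ∨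
      (q ≤ 1 / 2 ∧ (d / m) ^ 2 / 64 * q ≤ E / (8 * m)) := by
    by_cases hq2 : 1 / 2 ≤ q
    · left
      have h := hA (by linarith) (by linarith) (by linarith)
      rw [div_le_iff₀ (by positivity)] at h
      have : (d / m) ^ 2 / 640 * q * (8 * m) = d ^ 2 * q / (80 * m) := by field_simp; norm_num
      rw [this, div_le_iff₀ (by positivity)]
      nlinarith [sq_nonneg d]
    · right
      refine ⟨by linarith, ?_⟩
      have hS : ∑ u, (G.degree u : ℝ) * (avoid G v s u * avoid G v s u) = q * (2 * m) := by
        rw [hq]; field_simp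
      rw [hS] at hB
      rw [div_pow, le_div_iff₀ (mul_pos (by norm_num) hm)]
      have : d ^ 2 / m ^ 2 / 64 * q * (8 * m) = d ^ 2 * (q * (2 * m)) / (16 * m ^ 2) := by
        field_simp; norm_num
      rw [this, div_le_iff₀ (mul_pos (by norm_num) (pow_pos hm 2))]
      linarith
  rcases hkey with h | ⟨hq2, h⟩
  · have : (d / m) ^ 2 / 640 * q ≤ (1 - q) * (E / (8 * m)) := by
      rw [← mul_div_assoc, le_div_iff₀ (by positivity)]; exact h
    refine this.trans (mul_le_mul_of_nonneg_right (by linarith) (by positivity))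
  · have hL : 1 / 2 ≤ -Real.log q := by linarith
    have h2 : 0 ≤ E / (8 * m) := by positivity
    have h3 : 0 ≤ (d / m) ^ 2 * q := by positivity
    nlinarith

/-- With `L = -log q`, the recursion gives `L (L' - L) ≥ c/640`, hence `L'² ≥ L² + 2L(L' - L) ≥ L² +
c/320`. -/
theorem log_survival_sq_ge (hG : G.Connected) (hV : 2 ≤ Fintype.card V) (v : V) (s : ℕ)
    (hpos : 0 < survival G v (2 * s)) :
    ((G.minDegree : ℝ) / (G.edgeFinset.card : ℝ)) ^ 2 / 320 * (s + 1) ≤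
      Real.log (survival G v (2 * s)) ^ 2 := by
  have hm := edgeFinset_card_pos hG hV
  have hd1 : (1 : ℝ) ≤ G.minDegree := by exact_mod_cast minDegree_pos hG hV
  have h0 := survival_zero_le hG hV v
  induction s with
  | zero =>
    rw [mul_zero] at hpos ⊢
    have hlog := Real.log_le_sub_one_of_pos hpos
    have h1 : (G.minDegree : ℝ) / (G.edgeFinset.card : ℝ) / 2 ≤ -Real.log (survival G v 0) := by
      rw [div_div, mul_comm]; linarith
    have h2 : 0 ≤ (G.minDegree : ℝ) / (G.edgeFinset.card : ℝ) / 2 := by positivity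
    have h3 := mul_self_le_mul_self h2 h1
    push_cast
    nlinarith
  | succ s ih =>
    have hle : survival G v (2 * (s + 1)) ≤ survival G v (2 * s + 1) :=
      survival_antitone v (by omega)
    have hle' : survival G v (2 * s + 1) ≤ survival G v (2 * s) := survival_antitone v (by omega)
    have hq : 0 < survival G v (2 * s) := by linarith
    have hq0 : survival G v (2 * s) ≤ survival G v 0 := survival_antitone v (Nat.zero_le _)
    have hih := ih hq
    have hstep := survival_sub_ge hG hV v s hq
    have hdiv := Real.log_le_sub_one_of_pos (div_pos hpos hq)
    rw [Real.log_div hpos.ne' hq.ne'] at hdiv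
    have hlog := Real.log_le_sub_one_of_pos hq
    have hdm : 0 < (G.minDegree : ℝ) / (2 * (G.edgeFinset.card : ℝ)) := by positivity
    set q := survival G v (2 * s)
    set q' := survival G v (2 * (s + 1))
    set c := ((G.minDegree : ℝ) / (G.edgeFinset.card : ℝ)) ^ 2
    have hL : 0 < -Real.log q := by linarith
    have h1 : c / 640 ≤ -Real.log q * (1 - q' / q) := by
      rw [one_sub_div hq.ne', ← mul_div_assoc, le_div_iff₀ hq]
      exact hstep.trans (mul_le_mul_of_nonneg_left (by linarith) hL.le)
    have h2 : c / 640 ≤ -Real.log q * (Real.log q - Real.log q') :=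
      h1.trans (mul_le_mul_of_nonneg_left (by linarith) hL.le)
    push_cast
    nlinarith [sq_nonneg (Real.log q - Real.log q')]

theorem survival_le_exp (hG : G.Connected) (hV : 2 ≤ Fintype.card V) (v : V) (t : ℕ) :
    survival G v t ≤ Real.exp
      (-((G.minDegree : ℝ) / (G.edgeFinset.card : ℝ) / 26 * Real.sqrt (t + 1))) := by
  have hm := edgeFinset_card_pos hG hV
  have hd1 : (1 : ℝ) ≤ G.minDegree := by exact_mod_cast minDegree_pos hG hV
  have hle : survival G v t ≤ survival G v (2 * (t / 2)) := survival_antitone v (by omega)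
  refine hle.trans ?_
  -- A zero survival probability is treated apart, since `Real.log 0 = 0`.
  rcases (survival_nonneg (G := G) v (2 * (t / 2))).eq_or_lt with h | hpos
  · rw [← h]; positivity
  have h1 := log_survival_sq_ge hG hV v (t / 2) hpos
  have h0 := survival_zero_le hG hV v
  have hq0 : survival G v (2 * (t / 2)) ≤ survival G v 0 := survival_antitone v (Nat.zero_le _)
  have hlog := Real.log_le_sub_one_of_pos hpos
  have hdm : 0 < (G.minDegree : ℝ) / (2 * (G.edgeFinset.card : ℝ)) := by positivity
  rw [← Real.log_le_iff_le_exp hpos]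
  have ht : ((t : ℝ) + 1) / 2 ≤ ((t / 2 : ℕ) : ℝ) + 1 := by
    have : t + 1 ≤ 2 * (t / 2 + 1) := by omega
    have : (t : ℝ) + 1 ≤ 2 * (((t / 2 : ℕ) : ℝ) + 1) := by exact_mod_cast this
    linarith
  suffices (G.minDegree : ℝ) / (G.edgeFinset.card : ℝ) / 26 * Real.sqrt (t + 1) ≤
      -Real.log (survival G v (2 * (t / 2))) by linarith
  -- Halving the time turns `1/320` into `1/640`, and `26² = 676 ≥ 640`.
  refine (sq_le_sq₀ (by positivity) (by linarith)).1 ?_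
  rw [mul_pow, Real.sq_sqrt (by positivity), neg_sq]
  refine le_trans ?_ h1
  have hc : 0 ≤ ((G.minDegree : ℝ) / (G.edgeFinset.card : ℝ)) ^ 2 := by positivity
  have := mul_le_mul_of_nonneg_left ht hc
  have h5 : 0 ≤ ((G.minDegree : ℝ) / (G.edgeFinset.card : ℝ)) ^ 2 * ((t : ℝ) + 1) := by positivity
  rw [div_pow]
  nlinarith

end Decay

end MultiWalk

namespace MultiWalk

/-! ### From trajectory laws to avoidance probabilities. -/

section Law

set_option linter.unusedSectionVars false

variable {V : Type*} [Fintype V] [DecidableEq V] [MeasurableSpace V] [MeasurableSingletonClass V]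
  {G : SimpleGraph V} [DecidableRel G.Adj]

theorem isProbabilityMeasure_stationary (hm : (0 : ℝ) < G.edgeFinset.card) :
    IsProbabilityMeasure (stationary G) :=
  ⟨by
    simp only [stationary, Measure.coe_finsetSum, Finset.sum_apply, Measure.smul_apply,
      measure_univ, smul_eq_mul, mul_one]
    rw [← ENNReal.ofReal_sum_of_nonneg (fun v _ => by positivity), ← Finset.sum_div,
      sum_degree_real, div_self (by positivity), ENNReal.ofReal_one]⟩

theorem sum_smul_dirac_singleton (c : V → ℝ≥0∞) (u : V) :
    (∑ v, c v • Measure.dirac v) {u} = c u := by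
  simp only [Measure.coe_finsetSum, Finset.sum_apply, Measure.smul_apply, smul_eq_mul]
  rw [Finset.sum_eq_single u]
  · simp
  · intro b _ hb
    simp [hb]
  · simp

theorem stationary_singleton (u : V) : stationary G {u} =
    ENNReal.ofReal ((G.degree u : ℝ) / (2 * (G.edgeFinset.card : ℝ))) :=
  sum_smul_dirac_singleton _ u

theorem stepMeasure_singleton (u w : V) :
    stepMeasure G u {w} = ENNReal.ofReal (lazyMatrix G u w) :=
  sum_smul_dirac_singleton _ w

theorem walkLaw_preimage_zero (μ : Measure V) (u : V) :
    walkLaw G μ {x | x 0 = u} = μ {u} := by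
  have h1 : (walkLaw G μ).map (Preorder.frestrictLe (π := fun _ : ℕ => V) 0) =
      μ.map (MeasurableEquiv.piUnique (fun _ : Finset.Iic (0 : ℕ) => V)).symm := by
    rw [walkLaw, Kernel.trajMeasure, Measure.map_comp _ _ (by fun_prop),
      Kernel.traj_map_frestrictLe, Kernel.partialTraj_self, Measure.id_comp]
  have hset : {x : ℕ → V | x 0 = u} = Preorder.frestrictLe (π := fun _ : ℕ => V) 0 ⁻¹'
      {h | h ⟨0, Finset.mem_Iic.2 le_rfl⟩ = u} := rfl
  have hmeas : MeasurableSet {h : (i : Finset.Iic (0 : ℕ)) → (fun _ : ℕ => V) i |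
      h ⟨0, Finset.mem_Iic.2 le_rfl⟩ = u} :=
    measurable_pi_apply (X := fun _ : Finset.Iic (0 : ℕ) => V) ⟨0, Finset.mem_Iic.2 le_rfl⟩
      (measurableSet_singleton u)
  rw [hset, ← Measure.map_apply (Preorder.measurable_frestrictLe 0) hmeas, h1,
    Measure.map_apply (MeasurableEquiv.measurable _) hmeas]
  rfl

theorem measurableSet_eval_eq (t : ℕ) (w : V) : MeasurableSet {x : ℕ → V | x t = w} :=
  (measurable_pi_apply (X := fun _ : ℕ => V) t) (measurableSet_singleton w)

theorem measurableSet_avoid (v : V) (t : ℕ) : MeasurableSet {x : ℕ → V | ∀ s ≤ t, x s ≠ v} := by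
  simp only [Set.ofPred_forall]
  exact MeasurableSet.iInter fun s => MeasurableSet.iInter fun _ => (measurableSet_eval_eq s v).compl

/-- The Markov property of a walk avoiding `v`. -/
theorem walkLaw_avoid_succ (μ : Measure V) [IsProbabilityMeasure μ] (v u : V) (hu : u ≠ v) (t : ℕ) :
    walkLaw G μ {x | (∀ s ≤ t + 1, x s ≠ v) ∧ x (t + 1) = u} =
      ∑ w, walkLaw G μ {x | (∀ s ≤ t, x s ≠ v) ∧ x t = w} * ENNReal.ofReal (lazyMatrix G w u) := by
  set A : Set ((i : Finset.Iic t) → (fun _ : ℕ => V) i) := {h | ∀ s, h s ≠ v} with hA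
  have hAm : MeasurableSet A := by
    simp only [hA, Set.ofPred_forall]
    exact MeasurableSet.iInter fun s =>
      (measurable_pi_apply (X := fun _ : Finset.Iic t => V) s (measurableSet_singleton v)).compl
  have hset : {x : ℕ → V | (∀ s ≤ t + 1, x s ≠ v) ∧ x (t + 1) = u} =
      (fun x : ℕ → V => (Preorder.frestrictLe (π := fun _ : ℕ => V) t x, x (t + 1))) ⁻¹'
        (A ×ˢ {u}) := by
    ext x
    simp only [Set.mem_ofPred_eq, Set.mem_preimage, Set.mem_prod, Set.mem_singleton_iff, hA,
      Subtype.forall, Finset.mem_Iic]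
    constructor
    · rintro ⟨h1, h2⟩
      exact ⟨fun s hs => h1 s (by omega), h2⟩
    · rintro ⟨h1, h2⟩
      refine ⟨fun s hs => ?_, h2⟩
      rcases Nat.le_succ_iff.1 hs with hs | rfl
      · exact h1 s hs
      · exact h2 ▸ hu
  have hprod := Kernel.map_frestrictLe_trajMeasure_compProd_eq_map_trajMeasure
    (X := fun _ : ℕ => V) (μ₀ := μ) (κ := stepKernel G) (a := t)
  have hpm : Measurable
      (fun x : ℕ → V => (Preorder.frestrictLe (π := fun _ : ℕ => V) t x, x (t + 1))) := by fun_prop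
  have hprob : IsProbabilityMeasure
      ((Kernel.trajMeasure (X := fun _ : ℕ => V) μ (stepKernel G)).map (Preorder.frestrictLe t)) :=
    Measure.isProbabilityMeasure_map (by fun_prop)
  rw [hset, walkLaw, ← Measure.map_apply hpm (hAm.prod (measurableSet_singleton u)), ← hprod,
    Measure.compProd_apply_prod hAm (measurableSet_singleton u),
    setLIntegral_map hAm (Kernel.measurable_coe _ (measurableSet_singleton u))
      (Preorder.measurable_frestrictLe t)]
  have hBm : ∀ w, MeasurableSet {x : ℕ → V | (∀ s ≤ t, x s ≠ v) ∧ x t = w} := fun w =>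
    (measurableSet_avoid v t).inter (measurableSet_eval_eq t w)
  rw [← lintegral_indicator (Preorder.measurable_frestrictLe t hAm)]
  have hpt : ∀ x : ℕ → V,
      (Preorder.frestrictLe (π := fun _ : ℕ => V) t ⁻¹' A).indicator
        (fun x => stepKernel G t (Preorder.frestrictLe (π := fun _ : ℕ => V) t x) {u}) x =
      ∑ w, {x : ℕ → V | (∀ s ≤ t, x s ≠ v) ∧ x t = w}.indicator
        (fun _ => ENNReal.ofReal (lazyMatrix G w u)) x := by
    intro x
    have hmem : x ∈ Preorder.frestrictLe (π := fun _ : ℕ => V) t ⁻¹' A ↔ ∀ s ≤ t, x s ≠ v := by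
      simp only [Set.mem_preimage, hA, Set.mem_ofPred_eq, Subtype.forall, Finset.mem_Iic]
      rfl
    by_cases hx : ∀ s ≤ t, x s ≠ v
    · rw [Set.indicator_of_mem (hmem.2 hx), Finset.sum_eq_single (x t)]
      · rw [Set.indicator_of_mem
          (show x ∈ {y : ℕ → V | (∀ s ≤ t, y s ≠ v) ∧ y t = x t} from ⟨hx, rfl⟩)]
        exact stepMeasure_singleton _ _
      · intro b _ hb
        exact Set.indicator_of_notMem (fun h => hb h.2.symm) _
      · simp
    · rw [Set.indicator_of_notMem (fun h => hx (hmem.1 h))]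
      exact (Finset.sum_eq_zero fun w _ => Set.indicator_of_notMem (fun h => hx h.1) _).symm
  rw [lintegral_congr hpt, lintegral_finsetSum _ fun w _ => measurable_const.indicator (hBm w)]
  refine Finset.sum_congr rfl fun w _ => ?_
  rw [lintegral_indicator_const (hBm w), mul_comm]

/-- Time reversal: `u` is the end point on the left and the start point in `avoid G v t u`. The
induction uses detailed balance at each step. -/
theorem walkLaw_stationary_avoid_eq (hm : (0 : ℝ) < G.edgeFinset.card) (v u : V) (t : ℕ) :
    walkLaw G (stationary G) {x | (∀ s ≤ t, x s ≠ v) ∧ x t = u} =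
      ENNReal.ofReal ((G.degree u : ℝ) * avoid G v t u / (2 * (G.edgeFinset.card : ℝ))) := by
  have := isProbabilityMeasure_stationary hm
  by_cases hu : u = v
  · subst hu
    rw [avoid_self, mul_zero, zero_div, ENNReal.ofReal_zero]
    convert measure_empty (μ := walkLaw G (stationary G))
    ext x
    simp only [Set.mem_ofPred_eq, Set.mem_empty_iff_false, iff_false]
    exact fun h => h.1 t le_rfl h.2
  induction t generalizing u with
  | zero =>
    have : {x : ℕ → V | (∀ s ≤ 0, x s ≠ v) ∧ x 0 = u} = {x | x 0 = u} := by
      ext x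
      simp only [Set.mem_ofPred_eq, Nat.le_zero, forall_eq, and_iff_right_iff_imp]
      exact fun h => h ▸ hu
    rw [this, walkLaw_preimage_zero, stationary_singleton]
    simp [avoid, hu]
  | succ t ih =>
    rw [walkLaw_avoid_succ _ v u hu]
    have hw : ∀ w, walkLaw G (stationary G) {x | (∀ s ≤ t, x s ≠ v) ∧ x t = w} *
        ENNReal.ofReal (lazyMatrix G w u) =
        ENNReal.ofReal ((G.degree u : ℝ) * (lazyMatrix G u w * avoid G v t w) /
          (2 * (G.edgeFinset.card : ℝ))) := by
      intro w
      by_cases hwv : w = v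
      · subst hwv
        rw [avoid_self, mul_zero, mul_zero, zero_div, ENNReal.ofReal_zero]
        convert zero_mul _
        convert measure_empty (μ := walkLaw G (stationary G))
        ext x
        simp only [Set.mem_ofPred_eq, Set.mem_empty_iff_false, iff_false]
        exact fun h => h.1 t le_rfl h.2
      · have h0 := avoid_nonneg (G := G) v t w
        rw [ih w hwv, ← ENNReal.ofReal_mul (by positivity), ← mul_assoc (G.degree u : ℝ),
          degree_mul_lazyMatrix_symm]
        congr 1; ring
    rw [Finset.sum_congr rfl fun w _ => hw w, ← ENNReal.ofReal_sum_of_nonneg, ← Finset.sum_div,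
      ← Finset.mul_sum, avoid, if_neg hu]
    intro w _
    have h0 := avoid_nonneg (G := G) v t w
    have h1 := lazyMatrix_nonneg G u w
    positivity

theorem walkLaw_stationary_avoid (hm : (0 : ℝ) < G.edgeFinset.card) (v : V) (t : ℕ) :
    walkLaw G (stationary G) {x | ∀ s ≤ t, x s ≠ v} ≤ ENNReal.ofReal (survival G v t) := by
  have hset : {x : ℕ → V | ∀ s ≤ t, x s ≠ v} ⊆
      ⋃ u ∈ (Finset.univ : Finset V), {x | (∀ s ≤ t, x s ≠ v) ∧ x t = u} := fun x hx => by
    simpa using hx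
  refine (measure_mono hset).trans ((measure_biUnion_finset_le _ _).trans_eq ?_)
  rw [Finset.sum_congr rfl fun u _ => walkLaw_stationary_avoid_eq hm v u t,
    ← ENNReal.ofReal_sum_of_nonneg, ← Finset.sum_div, survival, avoidMass]
  intro u _
  have h0 := avoid_nonneg (G := G) v t u
  positivity

theorem multiWalkLaw_not_covered_le (hm : (0 : ℝ) < G.edgeFinset.card) (k t : ℕ) :
    multiWalkLaw G (stationary G) k {x | ¬ ∀ v : V, ∃ i : Fin k, ∃ s ≤ t, x i s = v} ≤
      ∑ v, ENNReal.ofReal (survival G v t) ^ k := by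
  have := isProbabilityMeasure_stationary hm
  have hp : IsProbabilityMeasure (walkLaw G (stationary G)) := by
    unfold walkLaw; infer_instance
  have hset : {x : Fin k → ℕ → V | ¬ ∀ v : V, ∃ i : Fin k, ∃ s ≤ t, x i s = v} ⊆
      ⋃ v ∈ (Finset.univ : Finset V),
        Set.univ.pi fun _ : Fin k => {y : ℕ → V | ∀ s ≤ t, y s ≠ v} := fun x hx => by
    simp only [Set.mem_ofPred_eq] at hx
    push Not at hx
    simpa [Set.mem_pi] using hx
  refine (measure_mono hset).trans ((measure_biUnion_finset_le _ _).trans ?_)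
  refine Finset.sum_le_sum fun v _ => ?_
  rw [multiWalkLaw, Measure.pi_pi, Finset.prod_const, Finset.card_univ, Fintype.card_fin]
  exact pow_le_pow_left₀ zero_le (walkLaw_stationary_avoid hm v t) k

theorem measurableSet_not_covered (k t : ℕ) :
    MeasurableSet {x : Fin k → ℕ → V | ¬ ∀ v : V, ∃ i : Fin k, ∃ s ≤ t, x i s = v} := by
  refine MeasurableSet.compl (s := {x : Fin k → ℕ → V | ∀ v : V, ∃ i : Fin k, ∃ s ≤ t, x i s = v}) ?_
  simp only [Set.ofPred_forall, Set.ofPred_exists, Set.ofPred_and]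
  refine MeasurableSet.iInter fun v => MeasurableSet.iUnion fun i => MeasurableSet.iUnion fun s =>
    (MeasurableSet.const _).inter ?_
  exact (measurable_pi_apply (X := fun _ : Fin k => ℕ → V) i) (measurableSet_eval_eq s v)

/-- The cover time counts the times at which some vertex is still unvisited. If covering never
occurs, the right side is infinite. -/
theorem coverTime_le_tsum {k : ℕ} (x : Fin k → ℕ → V) :
    coverTime x ≤ ∑' t : ℕ,
      {x : Fin k → ℕ → V | ¬ ∀ v : V, ∃ i : Fin k, ∃ s ≤ t, x i s = v}.indicator 1 x := by
  classical
  by_cases h : ∃ t : ℕ, ∀ v : V, ∃ i : Fin k, ∃ s ≤ t, x i s = v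
  · calc coverTime x ≤ (Nat.find h : ℝ≥0∞) := sInf_le ⟨Nat.find h, rfl, Nat.find_spec h⟩
      _ = ∑ t ∈ Finset.range (Nat.find h),
          {x : Fin k → ℕ → V | ¬ ∀ v : V, ∃ i : Fin k, ∃ s ≤ t, x i s = v}.indicator
            (1 : (Fin k → ℕ → V) → ℝ≥0∞) x := by
        rw [Finset.sum_congr rfl fun t ht =>
          Set.indicator_of_mem (Nat.find_min h (Finset.mem_range.1 ht)) 1]
        simp
      _ ≤ _ := ENNReal.sum_le_tsum _
  · rw [not_exists] at h
    rw [tsum_congr fun t => Set.indicator_of_mem (h t) (1 : (Fin k → ℕ → V) → ℝ≥0∞)]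
    simp

theorem expectedCoverTime_le (μ : Measure V) (k : ℕ) :
    expectedCoverTime G μ k ≤ ∑' t : ℕ,
      multiWalkLaw G μ k {x | ¬ ∀ v : V, ∃ i : Fin k, ∃ s ≤ t, x i s = v} := by
  refine (lintegral_mono coverTime_le_tsum).trans_eq ?_
  rw [lintegral_tsum fun t =>
    (measurable_one.indicator (measurableSet_not_covered k t)).aemeasurable]
  exact tsum_congr fun t => lintegral_indicator_one (measurableSet_not_covered k t)

end Law

/-! ### Summation over time and conclusion. -/

/-- If the terms are at most `min 1 (n e^{-a √(t+1)})`, then their sum is `O((log n / a)²)`. -/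
theorem tsum_min_one_exp_le {n a : ℝ} (hn : 2 ≤ n) (ha : 0 < a) (p : ℕ → ℝ≥0∞)
    (h1 : ∀ t, p t ≤ 1)
    (hexp : ∀ t, p t ≤ ENNReal.ofReal (n * Real.exp (-(a * Real.sqrt (t + 1))))) :
    ∑' t, p t ≤ ENNReal.ofReal (200 * (Real.log n / a) ^ 2) := by
  have hlog2 : 0.69 < Real.log n :=
    lt_of_lt_of_le (by linarith [Real.log_two_gt_d9]) (Real.log_le_log (by norm_num) hn)
  set S : ℝ := 50 * (Real.log n / a) ^ 2 with hS
  have hSpos : 0 < S := by positivity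
  -- One telescoping majorant, at least `4S²/(t+1+S)²`, covers both ranges: it is at least `1` for
  -- `t + 1 ≤ S` and at least `S²/(t+1)²` beyond. Its total is at most `4S`.
  have hterm : ∀ t : ℕ, p t ≤ ENNReal.ofReal (4 * S ^ 2 * (1 / (t + S) - 1 / ((t + 1 : ℕ) + S))) := by
    intro t
    have ht0 : (0 : ℝ) ≤ t := Nat.cast_nonneg t
    have hlow : 4 * S ^ 2 / (t + 1 + S) ^ 2 ≤
        4 * S ^ 2 * (1 / (t + S) - 1 / ((t + 1 : ℕ) + S)) := by
      push_cast
      rw [div_eq_mul_one_div]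
      refine mul_le_mul_of_nonneg_left ?_ (by positivity)
      rw [div_sub_div _ _ (by positivity) (by positivity),
        div_le_div_iff₀ (by positivity) (by positivity)]
      nlinarith
    by_cases hts : (t : ℝ) + 1 ≤ S
    · refine (h1 t).trans ?_
      rw [← ENNReal.ofReal_one]
      refine ENNReal.ofReal_le_ofReal (le_trans ?_ hlow)
      rw [le_div_iff₀ (by positivity)]
      nlinarith
    · push Not at hts
      refine (hexp t).trans (ENNReal.ofReal_le_ofReal (le_trans ?_ hlow))
      have hbase : S ^ 2 / ((t : ℝ) + 1) ^ 2 ≤ 4 * S ^ 2 / (t + 1 + S) ^ 2 := by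
        rw [div_le_div_iff₀ (by positivity) (by positivity)]
        have : ((t : ℝ) + 1 + S) ^ 2 ≤ 4 * (t + 1) ^ 2 := by nlinarith
        nlinarith [sq_nonneg S]
      refine le_trans ?_ hbase
      have hsq := Real.sq_sqrt (show (0 : ℝ) ≤ t + 1 by positivity)
      set r := Real.sqrt ((t : ℝ) + 1)
      have hr : 0 ≤ r := Real.sqrt_nonneg _
      -- Beyond `S`, half of the exponent absorbs the factor `n`; the other half beats `(t+1)^2`
      -- through `e^x ≥ x⁴/24`.
      have hx : 2 * Real.log n ≤ a * r := by
        refine (sq_le_sq₀ (by linarith) (by positivity)).1 ?_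
        have : S * a ^ 2 = 50 * Real.log n ^ 2 := by rw [hS]; field_simp
        nlinarith [sq_nonneg a, sq_nonneg (Real.log n)]
      have hnexp : n ≤ Real.exp (a * r / 2) := by
        rw [← Real.exp_log (show 0 < n by linarith)]
        exact Real.exp_le_exp.2 (by linarith)
      have hrpos : 0 < r := by
        by_contra! h
        nlinarith
      have hpow := Real.pow_div_factorial_le_exp (x := a * r / 2) (by positivity) 4
      have h24 : ((Nat.factorial 4 : ℕ) : ℝ) = 24 := by norm_num [Nat.factorial]
      rw [h24] at hpow
      have hxe : n * Real.exp (-(a * r)) ≤ 1 / Real.exp (a * r / 2) := by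
        rw [le_div_iff₀ (Real.exp_pos _), mul_assoc, ← Real.exp_add]
        calc n * Real.exp (-(a * r) + a * r / 2)
            ≤ Real.exp (a * r / 2) * Real.exp (-(a * r) + a * r / 2) :=
              mul_le_mul_of_nonneg_right hnexp (Real.exp_pos _).le
          _ = 1 := by rw [← Real.exp_add, ← Real.exp_zero]; congr 1; ring
      refine hxe.trans ((one_div_le_one_div_of_le (by positivity) hpow).trans ?_)
      rw [← hsq, div_le_div_iff₀ (by positivity) (by positivity), hS]
      have hl4 : 0.2 ≤ Real.log n ^ 4 := by
        have : (0.69 : ℝ) ^ 4 ≤ Real.log n ^ 4 := pow_le_pow_left₀ (by norm_num) hlog2.le 4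
        norm_num at this ⊢; linarith
      have : (50 * (Real.log n / a) ^ 2) ^ 2 * ((a * r / 2) ^ 4 / 24) =
          2500 / 384 * Real.log n ^ 4 * r ^ 4 := by field_simp; norm_num
      rw [this]
      have : 0 ≤ r ^ 4 := by positivity
      nlinarith
  refine ENNReal.tsum_le_of_sum_range_le fun N => ?_
  refine (Finset.sum_le_sum fun t _ => hterm t).trans ?_
  have hanti : ∀ t : ℕ, 0 ≤ 4 * S ^ 2 * (1 / ((t : ℝ) + S) - 1 / ((t + 1 : ℕ) + S)) := fun t => by
    refine mul_nonneg (by positivity) (sub_nonneg.2 ?_)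
    exact one_div_le_one_div_of_le (by positivity) (by push_cast; linarith)
  rw [← ENNReal.ofReal_sum_of_nonneg fun t _ => hanti t, ← Finset.mul_sum,
    Finset.sum_range_sub' (fun t : ℕ => 1 / ((t : ℝ) + S))]
  refine ENNReal.ofReal_le_ofReal ?_
  have h0 : 0 ≤ 1 / ((N : ℝ) + S) := by positivity
  calc 4 * S ^ 2 * (1 / (((0 : ℕ) : ℝ) + S) - 1 / ((N : ℝ) + S))
      ≤ 4 * S ^ 2 * (1 / S) := by
        refine mul_le_mul_of_nonneg_left ?_ (by positivity)
        rw [Nat.cast_zero, zero_add]; linarith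
    _ = 200 * (Real.log n / a) ^ 2 := by
        have : 4 * S ^ 2 * (1 / S) = 4 * S := by field_simp
        rw [this, hS]; ring

end MultiWalk

theorem theorem3p1 :
    ∃ C : ℝ, 0 < C ∧
      ∀ (V : Type*) [Fintype V] [DecidableEq V] [MeasurableSpace V] [MeasurableSingletonClass V]
        (G : SimpleGraph V) [DecidableRel G.Adj],
        G.Connected → 2 ≤ Fintype.card V → ∀ k : ℕ, 1 ≤ k →
          MultiWalk.expectedCoverTime G (MultiWalk.stationary G) k ≤
            ENNReal.ofReal
              (C * ((G.edgeFinset.card : ℝ) / ((k : ℝ) * (G.minDegree : ℝ))) ^ 2 *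
                Real.log (Fintype.card V) ^ 2) := by
  -- The sum bound `200 (log n/a)²` is applied with `a = k d/(26m)`.
  refine ⟨200 * 26 ^ 2, by norm_num, ?_⟩
  intro V _ _ _ _ G _ hG hV k hk
  have hm := MultiWalk.edgeFinset_card_pos hG hV
  have hd : (0 : ℝ) < G.minDegree := by exact_mod_cast MultiWalk.minDegree_pos hG hV
  have hk' : (0 : ℝ) < k := by exact_mod_cast hk
  have hstat := MultiWalk.isProbabilityMeasure_stationary hm
  have hwalk : IsProbabilityMeasure (MultiWalk.walkLaw G (MultiWalk.stationary G)) := by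
    unfold MultiWalk.walkLaw; infer_instance
  have hprob : IsProbabilityMeasure (MultiWalk.multiWalkLaw G (MultiWalk.stationary G) k) := by
    unfold MultiWalk.multiWalkLaw; infer_instance
  have hsum := MultiWalk.tsum_min_one_exp_le (n := (Fintype.card V : ℝ))
    (a := k * ((G.minDegree : ℝ) / (G.edgeFinset.card : ℝ) / 26)) (by exact_mod_cast hV)
    (by positivity)
    (fun t => MultiWalk.multiWalkLaw G (MultiWalk.stationary G) k
      {x | ¬ ∀ v : V, ∃ i : Fin k, ∃ s ≤ t, x i s = v})
    (fun t => prob_le_one)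
    (fun t => by
      refine (MultiWalk.multiWalkLaw_not_covered_le hm k t).trans ?_
      calc ∑ v, ENNReal.ofReal (MultiWalk.survival G v t) ^ k
          ≤ ∑ _v : V, ENNReal.ofReal (Real.exp (-(k * ((G.minDegree : ℝ) /
              (G.edgeFinset.card : ℝ) / 26) * Real.sqrt (t + 1)))) := by
            refine Finset.sum_le_sum fun v _ => ?_
            have h0 := MultiWalk.survival_nonneg (G := G) v t
            rw [← ENNReal.ofReal_pow h0]
            refine ENNReal.ofReal_le_ofReal ?_
            refine (pow_le_pow_left₀ h0 (MultiWalk.survival_le_exp hG hV v t) k).trans_eq ?_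
            rw [← Real.exp_nat_mul]
            congr 1; ring
        _ = _ := by
            rw [Finset.sum_const, Finset.card_univ, nsmul_eq_mul,
              ENNReal.ofReal_mul (Nat.cast_nonneg _), ENNReal.ofReal_natCast])
  refine (MultiWalk.expectedCoverTime_le _ k).trans (hsum.trans_eq ?_)
  congr 1
  field_simp
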